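/- \textbf{Conventions.} $\mathbf{Cat}$ is the 2-category of small categories; a 2-category $\mathcal{C}$ has small hom-categories $\mathcal{C}(U,L)$, and 2-functors are strict. Let $\mathcal{A}$ be a small 2-category, $\mathcal{C}$ a 2-category, and let $F\colon\mathcal{A}\to\mathcal{C}$ and $W\colon\mathcal{A}\to\mathbf{Cat}$ be 2-functors. The \emph{limit of $F$ weighted by $W$}, denoted $\{W,F\}$, is (if it exists) an object $L\in\mathcal{C}$ together with an isomorphism of categories $$\mathcal{C}(U,L)\cong[\mathcal{A},\mathbf{Cat}]\bigl(W,\mathcal{C}(U,F(-))\bigr),$$ 2-natural in $U\in\mathcal{C}^{\mathrm{op}}$, where the right-hand side is the category of 2-natural transformations and modifications. The \emph{2-category of elements} $\int W$ has as objects the pairs $(A,X)$ with $A\in\mathcal{A}$ and $X\in W(A)$; as morphisms $(A,X)\to(B,X')$ the pairs $(f,\alpha)$ with $f\colon A\to B$ in $\mathcal{A}$ and $\alpha\colon W(f)(X)\to X'$ in $W(B)$, with composition $(g,\beta)\circ(f,\alpha)=(g\circ f,\ \beta\circ W(g)(\alpha))$; and as 2-cells $(f,\alpha)\Rightarrow(g,\beta)$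 the 2-cells $\delta\colon f\Rightarrow g$ in $\mathcal{A}$ with $\alpha=\beta\circ W(\delta)_X$, composed as in $\mathcal{A}$. Let $\pi_W\colon\int W\to\mathcal{A}$ be the projection 2-functor $(A,X)\mapsto A$. For 2-functors $M,N\colon\int W\to\mathcal{D}$, a lax natural transformation $\sigma\colon M\to N$ has structure 2-cells $\sigma_\xi\colon N(\xi)\circ\sigma_{P}\Rightarrow\sigma_{Q}\circ M(\xi)$ for $\xi\colon P\to Q$; it is \emph{cartesian-marked} if $\sigma_\xi$ is an identity for every $\xi$ of the form $(f,\mathrm{id})\colon(A,X)\to(B,W(f)(X))$. For a 2-functor $G\colon\int W\to\mathcal{C}$, the \emph{cartesian-marked lax conical limit} of $G$ is (if it exists) an object $L\in\mathcal{C}$ together with an isomorphism, 2-natural in $U\in\mathcal{C}^{\mathrm{op}}$, between $\mathcal{C}(U,L)$ and the category of cartesian-marked lax natural transformations $\Delta 1\to\mathcal{C}(U,G(-))$ (where $\Delta 1$ is constant at the terminal category) and modifications between them. \textbf{Theorem.} Every weighted 2-limit can be reduced to a cartesian-marked lax conical one: the weighted limit $\{W,F\}$ is isomorphic to the cartesian-marked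 lax conical limit of $F\circ\pi_W\colon\int W\to\mathcal{C}$, either side existing if the other does. That is, an object $L\in\mathcal{C}$ is a limit of $F$ weighted by $W$ (for some 2-natural isomorphism as above) if and only if it is a cartesian-marked lax conical limit of $F\circ\pi_W$ (for some such isomorphism), and any object $L$ of the first kind is isomorphic in $\mathcal{C}$ to any object $L'$ of the second kind. -/

import Mathlib

open CategoryTheory Bicategory Opposite

universe w v u w₁ v₁ u₁ w₂ v₂ u₂ κ

namespace TwoLimits

section Elements

variable {A : Type u₁} [Bicategory.{w₁, v₁} A]

/-- Objects of the 2-category of elements of `W`. -/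
structure Elements (W : StrictPseudofunctor A Cat.{w, v}) where
  base : A
  fiber : W.obj base

namespace Elements

variable {W : StrictPseudofunctor A Cat.{w, v}}

/-- A morphism `(A, X) ⟶ (B, Y)`: a pair of `f : A ⟶ B` and `α : W(f)(X) ⟶ Y`. -/
structure Hom (P Q : Elements W) where
  base : P.base ⟶ Q.base
  fiber : (W.map base).toFunctor.obj P.fiber ⟶ Q.fiber

/-- Identities are `(𝟙, 𝟙)` and composites are `(f ≫ g, W(g)(α) ≫ β)`; the components of `W.mapId`
and `W.mapComp` are the identities `W(𝟙)(X) = X` and `W(f ≫ g)(X) = W(g)(W(f)(X))`. -/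
instance : CategoryStruct (Elements W) where
  Hom P Q := Hom P Q
  id P := ⟨𝟙 P.base, (W.mapId P.base).hom.toNatTrans.app P.fiber⟩
  comp {P _ _} f g := ⟨f.base ≫ g.base,
    (W.mapComp f.base g.base).hom.toNatTrans.app P.fiber ≫
      (W.map g.base).toFunctor.map f.fiber ≫ g.fiber⟩

@[simp] theorem id_base (P : Elements W) : (𝟙 P : P ⟶ P).base = 𝟙 P.base := rfl

@[simp] theorem id_fiber (P : Elements W) :
    (𝟙 P : P ⟶ P).fiber = (W.mapId P.base).hom.toNatTrans.app P.fiber := rfl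

@[simp] theorem comp_base {P Q R : Elements W} (f : P ⟶ Q) (g : Q ⟶ R) :
    (f ≫ g).base = f.base ≫ g.base := rfl

@[simp] theorem comp_fiber {P Q R : Elements W} (f : P ⟶ Q) (g : Q ⟶ R) :
    (f ≫ g).fiber = (W.mapComp f.base g.base).hom.toNatTrans.app P.fiber ≫
      (W.map g.base).toFunctor.map f.fiber ≫ g.fiber := rfl

/-- A 2-cell `(f, α) ⟶ (g, β)`: a 2-cell `η : f ⟶ g` such that `α = β ∘ W(η)_X`. -/
@[ext]
structure Hom₂ {P Q : Elements W} (f g : P ⟶ Q) where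
  base : f.base ⟶ g.base
  w : f.fiber = (W.map₂ base).toNatTrans.app P.fiber ≫ g.fiber

instance homCategory (P Q : Elements W) : Category (P ⟶ Q) where
  Hom f g := Hom₂ f g
  id f := ⟨𝟙 f.base, by simp⟩
  comp η θ := ⟨η.base ≫ θ.base, by rw [η.w, θ.w]; simp⟩
  id_comp _ := Hom₂.ext (Category.id_comp _)
  comp_id _ := Hom₂.ext (Category.comp_id _)
  assoc _ _ _ := Hom₂.ext (Category.assoc _ _ _)

theorem hom₂_ext {P Q : Elements W} {f g : P ⟶ Q} {η θ : f ⟶ g} (h : η.base = θ.base) : η = θ :=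
  Hom₂.ext h

/-- An invertible 2-cell of `A` compatible with the fibre parts is an invertible 2-cell. -/
def isoMk {P Q : Elements W} {f g : P ⟶ Q} (e : f.base ≅ g.base)
    (h : f.fiber = (W.map₂ e.hom).toNatTrans.app P.fiber ≫ g.fiber) : f ≅ g where
  hom := Hom₂.mk e.hom h
  inv := Hom₂.mk e.inv (by
    rw [h, ← Category.assoc, ← Cat.Hom₂.comp_app, ← PrelaxFunctor.map₂_comp]
    simp)
  hom_inv_id := hom₂_ext e.hom_inv_id
  inv_hom_id := hom₂_ext e.inv_hom_id

/-- The 2-category of elements; all compositions of 2-cells are inherited from `A`. -/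
instance bicategory : Bicategory (Elements W) where
  homCategory := homCategory
  whiskerLeft f _ _ η := Hom₂.mk (f.base ◁ η.base) (by simp [η.w])
  whiskerRight η h := Hom₂.mk (η.base ▷ h.base) (by simp [η.w])
  associator f g h := isoMk (α_ f.base g.base h.base) (by simp)
  leftUnitor f := isoMk (λ_ f.base) (by simp)
  rightUnitor f := isoMk (ρ_ f.base) (by simp)
  whiskerLeft_id _ _ := hom₂_ext (whiskerLeft_id _ _)
  whiskerLeft_comp _ _ _ _ _ _ := hom₂_ext (whiskerLeft_comp _ _ _)
  id_whiskerLeft _ := hom₂_ext (id_whiskerLeft _)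
  comp_whiskerLeft _ _ _ _ _ := hom₂_ext (comp_whiskerLeft _ _ _)
  id_whiskerRight _ _ := hom₂_ext (id_whiskerRight _ _)
  comp_whiskerRight _ _ _ := hom₂_ext (comp_whiskerRight _ _ _)
  whiskerRight_id _ := hom₂_ext (whiskerRight_id _)
  whiskerRight_comp _ _ _ := hom₂_ext (whiskerRight_comp _ _ _)
  whisker_assoc _ _ _ _ _ := hom₂_ext (whisker_assoc _ _ _)
  whisker_exchange _ _ := hom₂_ext (whisker_exchange _ _)
  pentagon _ _ _ _ := hom₂_ext (pentagon _ _ _ _)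
  triangle _ _ := hom₂_ext (triangle _ _)

theorem hom_ext {P Q : Elements W} {f g : P ⟶ Q} (h : f.base = g.base)
    (h' : f.fiber = eqToHom (by rw [h]) ≫ g.fiber) : f = g := by
  obtain ⟨f, α⟩ := f
  obtain ⟨g, β⟩ := g
  dsimp at h
  subst h
  obtain rfl : α = β := by simpa using h'
  rfl

theorem eqToHom_base {P Q : Elements W} {f g : P ⟶ Q} (h : f = g) :
    Hom₂.base (eqToHom h) = eqToHom (congrArg Hom.base h) := by
  subst h
  rfl

theorem iso_eq_eqToIso {P Q : Elements W} {f g : P ⟶ Q} (e : f ≅ g) (h : f = g)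
    (h' : Hom₂.base e.hom = eqToHom (congrArg Hom.base h)) : e = eqToIso h := by
  ext
  exact hom₂_ext (h'.trans (eqToHom_base h).symm)

instance [Strict A] : Strict (Elements W) where
  id_comp {P Q} f := hom_ext (Strict.id_comp f.base) (by
    simp [W.mapId_eq_eqToIso, W.mapComp_eq_eqToIso, eqToHom_map])
  comp_id {P Q} f := hom_ext (Strict.comp_id f.base) (by
    have e := Functor.congr_hom congr(($(W.map_id Q.base)).toFunctor) f.fiber
    simp at e
    simp [W.mapId_eq_eqToIso, W.mapComp_eq_eqToIso, e])
  assoc {P Q R S} f g h := hom_ext (Strict.assoc f.base g.base h.base) (by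
    have e := Functor.congr_hom congr(($(W.map_comp g.base h.base)).toFunctor) f.fiber
    simp at e
    simp [W.mapComp_eq_eqToIso, eqToHom_map, e])
  leftUnitor_eqToIso f := iso_eq_eqToIso _ _ (congrArg Iso.hom (Strict.leftUnitor_eqToIso f.base))
  rightUnitor_eqToIso f := iso_eq_eqToIso _ _ (congrArg Iso.hom (Strict.rightUnitor_eqToIso f.base))
  associator_eqToIso f g h :=
    iso_eq_eqToIso _ _ (congrArg Iso.hom (Strict.associator_eqToIso f.base g.base h.base))

/-- The projection 2-functor `(A, X) ↦ A`. -/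
def proj (W : StrictPseudofunctor A Cat.{w, v}) : StrictPseudofunctor (Elements W) A :=
  StrictPseudofunctor.mk'
    { obj P := P.base
      map f := f.base
      map₂ η := Hom₂.base η
      map₂_id _ := rfl
      map₂_comp _ _ := rfl
      map₂_whisker_left f _ _ η := by
        simp only [eqToHom_refl, Category.comp_id, Category.id_comp]; rfl
      map₂_whisker_right η f := by
        simp only [eqToHom_refl, Category.comp_id, Category.id_comp]; rfl
      map₂_left_unitor f := by simp only [eqToHom_refl, Category.id_comp]; rfl
      map₂_right_unitor f := by simp only [eqToHom_refl, Category.id_comp]; rfl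
      map₂_associator f g h := by
        simp only [eqToHom_refl, Category.comp_id, Category.id_comp]; rfl }

/-- The chosen cartesian morphisms: `(f, 𝟙) : (A, X) ⟶ (B, W(f)(X))`. -/
def IsCartesian ⦃P Q : Elements W⦄ (f : P ⟶ Q) : Prop :=
  ∃ h : (W.map f.base).toFunctor.obj P.fiber = Q.fiber, f.fiber = eqToHom h

end Elements
end Elements

section Transformations

open scoped Lax.LaxTrans

variable {B : Type u₁} [Bicategory.{w₁, v₁} B] {D : Type u₂} [Bicategory.{w₂, v₂} D]

/-- The underlying lax functor of a 2-functor. -/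
abbrev toLax (M : StrictPseudofunctor B D) : B ⥤ᴸ D := M.toPseudofunctor.toLax

theorem toLax_mapId (M : StrictPseudofunctor B D) (a : B) :
    (toLax M).mapId a = eqToHom (M.map_id a).symm := by
  change (M.mapId a).inv = _
  rw [M.mapId_eq_eqToIso]
  rfl

theorem toLax_mapComp (M : StrictPseudofunctor B D) {a b c : B} (f : a ⟶ b) (g : b ⟶ c) :
    (toLax M).mapComp f g = eqToHom (M.map_comp f g).symm := by
  change (M.mapComp f g).inv = _
  rw [M.mapComp_eq_eqToIso]
  rfl

theorem toLax_mapId_app (M : StrictPseudofunctor B Cat.{w, v}) (a : B) (k : M.obj a) :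
    ((toLax M).mapId a).toNatTrans.app k =
      eqToHom congr(($((M.map_id a).symm)).toFunctor.obj k) := by
  rw [toLax_mapId]
  exact Cat.eqToHom_app _ _ _ _

theorem toLax_mapComp_app (M : StrictPseudofunctor B Cat.{w, v}) {a b c : B} (f : a ⟶ b)
    (g : b ⟶ c) (k : M.obj a) :
    ((toLax M).mapComp f g).toNatTrans.app k =
      eqToHom congr(($((M.map_comp f g).symm)).toFunctor.obj k) := by
  rw [toLax_mapComp]
  exact Cat.eqToHom_app _ _ _ _

/-- The 2-cell `η` is an identity. -/
def IsIdentity {a b : D} {f g : a ⟶ b} (η : f ⟶ g) : Prop :=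
  ∃ h : f = g, η = eqToHom h

theorem IsIdentity.comp {a b : D} {f g h : a ⟶ b} {η : f ⟶ g} {θ : g ⟶ h} (hη : IsIdentity η)
    (hθ : IsIdentity θ) : IsIdentity (η ≫ θ) := by
  obtain ⟨rfl, rfl⟩ := hη
  obtain ⟨rfl, rfl⟩ := hθ
  exact ⟨rfl, by simp⟩

theorem IsIdentity.whiskerLeft {a b c : D} (f : a ⟶ b) {g h : b ⟶ c} {η : g ⟶ h}
    (hη : IsIdentity η) : IsIdentity (f ◁ η) := by
  obtain ⟨rfl, rfl⟩ := hη
  exact ⟨rfl, by simp⟩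

theorem IsIdentity.whiskerRight {a b c : D} {f g : a ⟶ b} {η : f ⟶ g} (hη : IsIdentity η)
    (h : b ⟶ c) : IsIdentity (η ▷ h) := by
  obtain ⟨rfl, rfl⟩ := hη
  exact ⟨rfl, by simp⟩

/-- Lax natural transformations whose structure 2-cells on the morphisms in `S` are identities. -/
def MarkedLax (S : ∀ ⦃a b : B⦄, (a ⟶ b) → Prop) (M N : StrictPseudofunctor B D) :
    ObjectProperty (toLax M ⟶ toLax N) :=
  fun σ => ∀ ⦃a b : B⦄ (f : a ⟶ b), S f → IsIdentity (σ.naturality f)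

/-- 2-natural transformations: all structure 2-cells are identities. -/
abbrev TwoNatural (M N : StrictPseudofunctor B D) : ObjectProperty (toLax M ⟶ toLax N) :=
  MarkedLax (fun _ _ _ => True) M N

/-- Isomorphisms of 2-functors: 2-natural transformations with a 2-natural inverse. -/
structure TwoNatIso (M N : StrictPseudofunctor B D) where
  hom : toLax M ⟶ toLax N
  inv : toLax N ⟶ toLax M
  hom_natural : TwoNatural M N hom
  inv_natural : TwoNatural N M inv
  hom_inv_id (a : B) : hom.app a ≫ inv.app a = 𝟙 (M.obj a)
  inv_hom_id (a : B) : inv.app a ≫ hom.app a = 𝟙 (N.obj a)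

/-- The 2-functor constant at the terminal category. -/
def terminalWeight (B : Type u₁) [Bicategory.{w₁, v₁} B] : StrictPseudofunctor B Cat.{κ, κ} :=
  StrictPseudofunctor.mk'
    { obj _ := Cat.of (Discrete PUnit.{κ + 1})
      map _ := 𝟙 _
      map₂ _ := 𝟙 _
      map₂_id _ := rfl
      map₂_comp _ _ := rfl
      map_comp _ _ := rfl
      map₂_whisker_left _ _ _ _ := by rfl
      map₂_whisker_right _ _ := by rfl
      map₂_left_unitor _ := by rfl
      map₂_right_unitor _ := by rfl
      map₂_associator _ _ _ := by rfl }

end Transformations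

section Representables

variable {C : Type u} [Bicategory.{w, v} C] [Strict C]

theorem unop2_eqToHom {a b : Cᵒᵖ} {f g : a ⟶ b} (h : f = g) :
    Bicategory.Opposite.Hom2.unop2 (eqToHom h) = eqToHom (congrArg Quiver.Hom.unop h) := by
  subst h
  rfl

theorem op_iso_eq_eqToIso {a b : Cᵒᵖ} {f g : a ⟶ b} (e : f ≅ g) (h : f = g)
    (h' : e.hom.unop2 = eqToHom (congrArg Quiver.Hom.unop h)) : e = eqToIso h := by
  subst h
  ext
  exact congrArg Bicategory.Opposite.Hom2.op2' h'

instance : Strict Cᵒᵖ where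
  id_comp f := congrArg Quiver.Hom.op (Strict.comp_id f.unop)
  comp_id f := congrArg Quiver.Hom.op (Strict.id_comp f.unop)
  assoc f g h := congrArg Quiver.Hom.op (Strict.assoc h.unop g.unop f.unop).symm
  leftUnitor_eqToIso f :=
    op_iso_eq_eqToIso _ _ (congrArg Iso.hom (Strict.rightUnitor_eqToIso f.unop))
  rightUnitor_eqToIso f :=
    op_iso_eq_eqToIso _ _ (congrArg Iso.hom (Strict.leftUnitor_eqToIso f.unop))
  associator_eqToIso f g h :=
    op_iso_eq_eqToIso _ _ (congrArg Iso.inv (Strict.associator_eqToIso h.unop g.unop f.unop))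

theorem cat_functor_ext {X Y : Cat.{w₁, v₁}} {F G : X ⟶ Y}
    (h : ∀ k, F.toFunctor.obj k = G.toFunctor.obj k)
    (h' : ∀ ⦃k l⦄ (f : k ⟶ l), F.toFunctor.map f =
      eqToHom (h k) ≫ G.toFunctor.map f ≫ eqToHom (h l).symm) : F = G :=
  Cat.ext (CategoryTheory.Functor.ext h (fun _ _ f => h' f))

theorem cat_hom₂_ext {X Y : Cat.{w₁, v₁}} {F F' G G' : X ⟶ Y} (h : F = F') (h' : G' = G)
    (η : F ⟶ G) (θ : F' ⟶ G')
    (H : ∀ k, η.toNatTrans.app k = eqToHom (by rw [h]) ≫ θ.toNatTrans.app k ≫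
      eqToHom (by rw [h'])) : η = eqToHom h ≫ θ ≫ eqToHom h' := by
  subst h h'
  ext k
  simpa using H k

/-- The representable 2-functor `C(U, -)`. -/
def coyoneda (U : C) : StrictPseudofunctor C Cat.{w, v} :=
  StrictPseudofunctor.mk''
    { obj L := Cat.of (U ⟶ L)
      map f := (postcomp U f).toCatHom
      map₂ η := NatTrans.toCatHom₂ ((postcomposing U _ _).map η)
      map₂_id f := congrArg NatTrans.toCatHom₂ ((postcomposing U _ _).map_id f)
      map₂_comp η θ := congrArg NatTrans.toCatHom₂ ((postcomposing U _ _).map_comp η θ)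
      map_id L := cat_functor_ext (fun k => Strict.comp_id k) fun (k l : U ⟶ L) (η : k ⟶ l) => by
        change η ▷ 𝟙 L = eqToHom _ ≫ η ≫ eqToHom _
        simp [Strict.rightUnitor_eqToIso]
      map_comp {a b c} f g := cat_functor_ext (fun k => (Strict.assoc k f g).symm)
        fun (k l : U ⟶ a) (η : k ⟶ l) => by
          change η ▷ (f ≫ g) = eqToHom _ ≫ η ▷ f ▷ g ≫ eqToHom _
          simp [Strict.associator_eqToIso]
      map₂_whisker_left {a b c} f g g' η := cat_hom₂_ext _ _ _ _ fun (k : U ⟶ a) => by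
        change k ◁ f ◁ η = eqToHom (Strict.assoc k f g).symm ≫ (k ≫ f) ◁ η ≫
          eqToHom (Strict.assoc k f g')
        simp [Strict.associator_eqToIso]
      map₂_whisker_right {a b c} f f' η g := cat_hom₂_ext _ _ _ _ fun (k : U ⟶ a) => by
        change k ◁ η ▷ g = eqToHom (Strict.assoc k f g).symm ≫ (k ◁ η) ▷ g ≫
          eqToHom (Strict.assoc k f' g)
        simp [Strict.associator_eqToIso] }

/-- The representable 2-functor `C(-, L)`. -/
def yoneda (L : C) : StrictPseudofunctor Cᵒᵖ Cat.{w, v} :=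
  StrictPseudofunctor.mk''
    { obj U := Cat.of (U.unop ⟶ L)
      map u := (precomp L u.unop).toCatHom
      map₂ η := NatTrans.toCatHom₂ ((precomposing _ _ L).map η.unop2)
      map₂_id f := congrArg NatTrans.toCatHom₂ ((precomposing _ _ L).map_id f.unop)
      map₂_comp η θ :=
        congrArg NatTrans.toCatHom₂ ((precomposing _ _ L).map_comp η.unop2 θ.unop2)
      map_id U := cat_functor_ext (fun k => Strict.id_comp k)
        fun (k l : U.unop ⟶ L) (η : k ⟶ l) => by
          change 𝟙 U.unop ◁ η = eqToHom _ ≫ η ≫ eqToHom _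
          simp [Strict.leftUnitor_eqToIso]
      map_comp {a b c} f g := cat_functor_ext (fun k => Strict.assoc g.unop f.unop k)
        fun (k l : a.unop ⟶ L) (η : k ⟶ l) => by
          change (g.unop ≫ f.unop) ◁ η = eqToHom _ ≫ g.unop ◁ f.unop ◁ η ≫ eqToHom _
          simp [Strict.associator_eqToIso]
      map₂_whisker_left {a b c} f g g' η := cat_hom₂_ext _ _ _ _ fun (k : a.unop ⟶ L) => by
        change (η.unop2 ▷ f.unop) ▷ k = eqToHom (Strict.assoc g.unop f.unop k) ≫
          η.unop2 ▷ (f.unop ≫ k) ≫ eqToHom (Strict.assoc g'.unop f.unop k).symm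
        simp [Strict.associator_eqToIso]
      map₂_whisker_right {a b c} f f' η g := cat_hom₂_ext _ _ _ _ fun (k : a.unop ⟶ L) => by
        change (g.unop ◁ η.unop2) ▷ k = eqToHom _ ≫ g.unop ◁ η.unop2 ▷ k ≫ eqToHom _
        simp [Strict.associator_eqToIso] }

end Representables

section Limits

open scoped Lax.LaxTrans

variable {B : Type u₁} [Bicategory.{w₁, v₁} B] {C : Type u} [Bicategory.{w, v} C] [Strict C]

/-- The 2-functor `C(U, G -)`. -/
abbrev homFrom (U : C) (G : StrictPseudofunctor B C) : StrictPseudofunctor B Cat.{w, v} :=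
  G.comp (coyoneda U)

/-- Precomposition with `u : U ⟶ V`, as a transformation `C(V, G -) ⟶ C(U, G -)`;
its structure 2-cells are the associators of `C`, that is, identities. -/
def precompTrans {U V : C} (u : U ⟶ V) (G : StrictPseudofunctor B C) :
    toLax (homFrom V G) ⟶ toLax (homFrom U G) where
  app b := (precomp (G.obj b) u).toCatHom
  naturality {a b} f := NatTrans.toCatHom₂
    { app k := (α_ u k (G.map f)).hom
      naturality k l η := associator_naturality_middle u η (G.map f) }
  naturality_naturality {a b f g} η := by
    ext (k : V ⟶ G.obj a)
    change (α_ u k (G.map f)).hom ≫ u ◁ k ◁ G.map₂ η = (u ≫ k) ◁ G.map₂ η ≫ (α_ u k (G.map g)).hom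
    simp
  naturality_id a := by
    ext (k : V ⟶ G.obj a)
    have aux : ∀ (x : u ≫ k ⟶ (u ≫ k) ≫ G.map (𝟙 a)) (y : k ⟶ k ≫ G.map (𝟙 a))
        (hk : k = k ≫ G.map (𝟙 a)), x = eqToHom (by rw [Strict.assoc, ← hk]) → y = eqToHom hk →
        x ≫ (α_ u k (G.map (𝟙 a))).hom = 𝟙 (u ≫ k) ≫ 𝟙 (u ≫ k) ≫ u ◁ y := by
      rintro _ _ hk rfl rfl
      simp [Strict.associator_eqToIso]
    exact aux _ _ _ (toLax_mapId_app (homFrom U G) a (u ≫ k)) (toLax_mapId_app (homFrom V G) a k)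
  naturality_comp {a b c} f g := by
    ext (k : V ⟶ G.obj a)
    have aux : ∀ (x : ((u ≫ k) ≫ G.map f) ≫ G.map g ⟶ (u ≫ k) ≫ G.map (f ≫ g))
        (y : (k ≫ G.map f) ≫ G.map g ⟶ k ≫ G.map (f ≫ g))
        (hk : (k ≫ G.map f) ≫ G.map g = k ≫ G.map (f ≫ g)),
        x = eqToHom (by rw [Strict.assoc u, Strict.assoc u, hk, ← Strict.assoc]) →
        y = eqToHom hk → x ≫ (α_ u k (G.map (f ≫ g))).hom =
          𝟙 _ ≫ (α_ u k (G.map f)).hom ▷ G.map g ≫ 𝟙 _ ≫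
            (α_ u (k ≫ G.map f) (G.map g)).hom ≫ 𝟙 _ ≫ u ◁ y := by
      rintro _ _ hk rfl rfl
      simp [Strict.associator_eqToIso]
    exact aux _ _ _ (toLax_mapComp_app (homFrom U G) f g (u ≫ k))
      (toLax_mapComp_app (homFrom V G) f g k)

/-- A 2-cell `u ⟶ u'` induces a modification. -/
def precompModification {U V : C} {u u' : U ⟶ V} (η : u ⟶ u') (G : StrictPseudofunctor B C) :
    precompTrans u G ⟶ precompTrans u' G where
  as :=
    { app b := NatTrans.toCatHom₂ ((precomposing _ _ (G.obj b)).map η)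
      naturality {a b} f := by
        ext (k : V ⟶ G.obj a)
        change (η ▷ k) ▷ G.map f ≫ (α_ u' k (G.map f)).hom =
          (α_ u k (G.map f)).hom ≫ η ▷ (k ≫ G.map f)
        simp }

theorem isIdentity_cat {X Y : Cat.{w, v}} {F G : X ⟶ Y} (η : F ⟶ G)
    (H : ∀ k, ∃ h : F.toFunctor.obj k = G.toFunctor.obj k, η.toNatTrans.app k = eqToHom h) :
    IsIdentity η := by
  have h : F = G := cat_functor_ext (fun k => (H k).1) fun k l f => by
    have := η.toNatTrans.naturality f
    rw [(H k).2, (H l).2] at this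
    rw [← reassoc_of% this]
    simp
  refine ⟨h, ?_⟩
  ext k
  rw [(H k).2, Cat.eqToHom_app]

theorem precompTrans_twoNatural {U V : C} (u : U ⟶ V) (G : StrictPseudofunctor B C) :
    TwoNatural (homFrom V G) (homFrom U G) (precompTrans u G) := fun a _ f _ =>
  isIdentity_cat _ fun (k : V ⟶ G.obj a) =>
    ⟨Strict.assoc u k (G.map f), congrArg Iso.hom (Strict.associator_eqToIso u k (G.map f))⟩

theorem MarkedLax.comp {S : ∀ ⦃a b : B⦄, (a ⟶ b) → Prop} {M N P : StrictPseudofunctor B C}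
    {σ : toLax M ⟶ toLax N} {τ : toLax N ⟶ toLax P} (hσ : MarkedLax S M N σ)
    (hτ : MarkedLax S N P τ) : MarkedLax S M P (σ ≫ τ) := fun a b f hf => by
  have hα : ∀ {a b c d : C} (f : a ⟶ b) (g : b ⟶ c) (h : c ⟶ d), IsIdentity (α_ f g h).hom :=
    fun f g h => ⟨Strict.assoc f g h, congrArg Iso.hom (Strict.associator_eqToIso f g h)⟩
  have hα' : ∀ {a b c d : C} (f : a ⟶ b) (g : b ⟶ c) (h : c ⟶ d), IsIdentity (α_ f g h).inv :=
    fun f g h => ⟨(Strict.assoc f g h).symm, congrArg Iso.inv (Strict.associator_eqToIso f g h)⟩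
  exact (hα _ _ _).comp (((hτ f hf).whiskerLeft _).comp
    ((hα' _ _ _).comp (((hσ f hf).whiskerRight _).comp (hα _ _ _))))

variable (S : ∀ ⦃a b : B⦄, (a ⟶ b) → Prop) (M : StrictPseudofunctor B Cat.{w, v})
  (G : StrictPseudofunctor B C)

/-- The category of transformations `M ⟶ C(U, G -)` that are lax natural and whose structure
2-cells on `S` are identities; its morphisms are the modifications. -/
abbrev Cones (U : C) := (MarkedLax S M (homFrom U G)).FullSubcategory

/-- Restriction of cones along `u : U ⟶ V`. -/
def restrict {U V : C} (u : U ⟶ V) : Cones S M G V ⥤ Cones S M G U where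
  obj σ := ⟨σ.obj ≫ precompTrans u G,
    MarkedLax.comp σ.property fun _ _ f _ => precompTrans_twoNatural u G f trivial⟩
  map Γ := ObjectProperty.homMk (Lax.LaxTrans.whiskerRight Γ.hom (precompTrans u G))
  map_id σ := by
    ext1
    apply Lax.LaxTrans.homCategory.ext
    intro a
    exact id_whiskerRight _ _
  map_comp Γ Γ' := by
    ext1
    apply Lax.LaxTrans.homCategory.ext
    intro a
    exact comp_whiskerRight _ _ _

/-- The action of a 2-cell `u ⟶ u'` on cones. -/
def restrict₂ {U V : C} {u u' : U ⟶ V} (η : u ⟶ u') : restrict S M G u ⟶ restrict S M G u' where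
  app σ := ObjectProperty.homMk (Lax.LaxTrans.whiskerLeft σ.obj (precompModification η G))
  naturality σ τ Γ := by
    ext1
    apply Lax.LaxTrans.homCategory.ext
    intro a
    exact (whisker_exchange (Γ.hom.as.app a) _).symm

section

variable {S M G}

theorem laxTrans_ext {N : StrictPseudofunctor B Cat.{w, v}} {σ τ : toLax M ⟶ toLax N}
    (h : ∀ a, σ.app a = τ.app a)
    (h' : ∀ ⦃a b : B⦄ (f : a ⟶ b), σ.naturality f =
      eqToHom (by rw [h]) ≫ τ.naturality f ≫ eqToHom (by rw [h])) : σ = τ := by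
  obtain ⟨σ, σn, _, _, _⟩ := σ
  obtain ⟨τ, τn, _, _, _⟩ := τ
  obtain rfl : σ = τ := funext h
  obtain rfl : @σn = @τn := by
    funext a b f
    simpa using h' f
  rfl

theorem cones_hom_ext {U : C} {σ σ' τ τ' : Cones S M G U} (h : σ = σ') (h' : τ' = τ)
    (Γ : σ ⟶ τ) (Γ' : σ' ⟶ τ')
    (H : ∀ (a : B) (x : M.obj a), (Γ.hom.as.app a).toNatTrans.app x =
      eqToHom (by rw [h]) ≫ (Γ'.hom.as.app a).toNatTrans.app x ≫ eqToHom (by rw [h'])) :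
    Γ = eqToHom h ≫ Γ' ≫ eqToHom h' := by
  subst h h'
  ext1
  apply Lax.LaxTrans.homCategory.ext
  intro a
  ext x
  simpa using H a x

end

theorem id_whiskerLeft_aux {U Z : C} {k l : U ⟶ Z} (η : k ⟶ l) :
    𝟙 U ◁ η = eqToHom (Strict.id_comp k) ≫ η ≫ eqToHom (Strict.id_comp l).symm := by
  simp [Strict.leftUnitor_eqToIso]

theorem comp_whiskerLeft_aux {U V X Z : C} (u : U ⟶ V) (v : V ⟶ X) {k l : X ⟶ Z} (η : k ⟶ l) :
    (u ≫ v) ◁ η = eqToHom (Strict.assoc u v k) ≫ u ◁ v ◁ η ≫ eqToHom (Strict.assoc u v l).symm := by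
  simp [Strict.associator_eqToIso]

theorem restrict_id_obj {U : C} (σ : Cones S M G U) : (restrict S M G (𝟙 U)).obj σ = σ := by
  ext1
  refine laxTrans_ext (fun a => cat_functor_ext (fun x => Strict.id_comp _) fun x y f => ?_)
    fun a b f => cat_hom₂_ext _ _ _ _ fun x => ?_
  · exact id_whiskerLeft_aux (Z := G.obj a) ((σ.obj.app a).toFunctor.map f)
  · have aux : ∀ {Z Z' : C} {k : U ⟶ Z} {g : Z ⟶ Z'} {l : U ⟶ Z'} (η : k ≫ g ⟶ l),
        𝟙 _ ≫ (α_ (𝟙 U) k g).hom ≫ 𝟙 _ ≫ 𝟙 U ◁ η ≫ 𝟙 _ =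
          eqToHom (by rw [Strict.id_comp]) ≫ η ≫ eqToHom (Strict.id_comp l).symm := by
      intro Z Z' k g l η
      simp [Strict.associator_eqToIso, Strict.leftUnitor_eqToIso]
    exact aux (Z := G.obj a) (Z' := G.obj b) ((σ.obj.naturality f).toNatTrans.app x)

theorem restrict_comp_obj {U V X : C} (u : U ⟶ V) (v : V ⟶ X) (σ : Cones S M G X) :
    (restrict S M G (u ≫ v)).obj σ = (restrict S M G u).obj ((restrict S M G v).obj σ) := by
  ext1
  refine laxTrans_ext (fun a => cat_functor_ext (fun x => Strict.assoc _ _ _) fun x y f => ?_)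
    fun a b f => cat_hom₂_ext _ _ _ _ fun x => ?_
  · exact comp_whiskerLeft_aux (Z := G.obj a) u v ((σ.obj.app a).toFunctor.map f)
  · have aux : ∀ {Z Z' : C} {k : X ⟶ Z} {g : Z ⟶ Z'} {l : X ⟶ Z'} (η : k ≫ g ⟶ l),
        𝟙 _ ≫ (α_ (u ≫ v) k g).hom ≫ 𝟙 _ ≫ (u ≫ v) ◁ η ≫ 𝟙 _ =
          eqToHom (by rw [Strict.assoc u v]) ≫
            (𝟙 _ ≫ (α_ u (v ≫ k) g).hom ≫ 𝟙 _ ≫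
              u ◁ (𝟙 _ ≫ (α_ v k g).hom ≫ 𝟙 _ ≫ v ◁ η ≫ 𝟙 _) ≫ 𝟙 _) ≫
            eqToHom (Strict.assoc u v l).symm := by
      intro Z Z' k g l η
      simp [Strict.associator_eqToIso]
    exact aux (Z := G.obj a) (Z' := G.obj b) ((σ.obj.naturality f).toNatTrans.app x)

end Limits

section Conical

open scoped Lax.LaxTrans

/-- The 2-functor `U ↦ {transformations M ⟶ C(U, G -) as above}`. -/
def cones {B : Type κ} [Bicategory.{κ, κ} B] {C : Type u} [Bicategory.{κ, κ} C] [Strict C]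
    (S : ∀ ⦃a b : B⦄, (a ⟶ b) → Prop) (M : StrictPseudofunctor B Cat.{κ, κ})
    (G : StrictPseudofunctor B C) : StrictPseudofunctor Cᵒᵖ Cat.{κ, κ} :=
  StrictPseudofunctor.mk''
    { obj U := Cat.of (Cones S M G U.unop)
      map u := (restrict S M G u.unop).toCatHom
      map₂ η := NatTrans.toCatHom₂ (restrict₂ S M G η.unop2)
      map₂_id {a b} f := by
        ext (σ : Cones S M G a.unop)
        apply ObjectProperty.hom_ext
        apply Lax.LaxTrans.homCategory.ext
        intro c
        ext x
        exact id_whiskerRight f.unop ((show a.unop ⟶ G.obj c from (σ.obj.app c).toFunctor.obj x))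
      map₂_comp {a b f g h} η θ := by
        ext (σ : Cones S M G a.unop)
        apply ObjectProperty.hom_ext
        apply Lax.LaxTrans.homCategory.ext
        intro c
        ext x
        exact comp_whiskerRight η.unop2 θ.unop2
          ((show a.unop ⟶ G.obj c from (σ.obj.app c).toFunctor.obj x))
      map_id U := cat_functor_ext (fun σ => restrict_id_obj S M G σ)
        fun (σ τ : Cones S M G U.unop) (Γ : σ ⟶ τ) => cones_hom_ext _ _ _ _ fun a x =>
          id_whiskerLeft_aux (Z := G.obj a) ((Γ.hom.as.app a).toNatTrans.app x)
      map_comp {a b c} f g := cat_functor_ext (fun σ => restrict_comp_obj S M G g.unop f.unop σ)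
        fun (σ τ : Cones S M G a.unop) (Γ : σ ⟶ τ) => cones_hom_ext _ _ _ _ fun b x =>
          comp_whiskerLeft_aux (Z := G.obj b) g.unop f.unop ((Γ.hom.as.app b).toNatTrans.app x)
      map₂_whisker_left {a b c} f g g' η := cat_hom₂_ext _ _ _ _
        fun (σ : Cones S M G a.unop) => cones_hom_ext _ _ _ _ fun d x => by
          have aux : ∀ k : a.unop ⟶ G.obj d, (η.unop2 ▷ f.unop) ▷ k =
              eqToHom (Strict.assoc g.unop f.unop k) ≫ η.unop2 ▷ (f.unop ≫ k) ≫
                eqToHom (Strict.assoc g'.unop f.unop k).symm := by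
            intro k
            simp [Strict.associator_eqToIso]
          exact aux ((σ.obj.app d).toFunctor.obj x)
      map₂_whisker_right {a b c} f f' η g := cat_hom₂_ext _ _ _ _
        fun (σ : Cones S M G a.unop) => cones_hom_ext _ _ _ _ fun d x => by
          have aux : ∀ k : a.unop ⟶ G.obj d, (g.unop ◁ η.unop2) ▷ k =
              eqToHom (Strict.assoc g.unop f.unop k) ≫ g.unop ◁ η.unop2 ▷ k ≫
                eqToHom (Strict.assoc g.unop f'.unop k).symm := by
            intro k
            simp [Strict.associator_eqToIso]
          exact aux ((σ.obj.app d).toFunctor.obj x) }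

variable {A : Type κ} [Bicategory.{κ, κ} A] {C : Type u} [Bicategory.{κ, κ} C] [Strict C]

/-- `L` with an isomorphism `C(U, L) ≅ [A, Cat](W, C(U, F -))`, 2-natural in `U`. -/
abbrev WeightedLimit (W : StrictPseudofunctor A Cat.{κ, κ}) (F : StrictPseudofunctor A C) (L : C) :=
  TwoNatIso (yoneda L) (cones (fun _ _ _ => True) W F)

/-- `L` with an isomorphism, 2-natural in `U`, from `C(U, L)` to the category of cartesian-marked
lax natural transformations `Δ1 ⟶ C(U, G -)` and modifications. -/
abbrev CartesianLaxLimit (W : StrictPseudofunctor A Cat.{κ, κ})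
    (G : StrictPseudofunctor (Elements W) C) (L : C) :=
  TwoNatIso (yoneda L) (cones Elements.IsCartesian (terminalWeight (Elements W)) G)

end Conical

end TwoLimits

/-! A weighted cone with vertex `U` consists of 1-cells `p_X : U ⟶ F A`, one for each `X` in `W(A)`,
and 2-cells `p_X ⟶ p_Y`, functorial in the fibre morphisms `X ⟶ Y`, such that `p_X ≫ F f =
p_{W(f)X}`, naturally in `X` and compatibly with the 2-cells of `A`. A lax cone on the elements has
the same 1-cells and a 2-cell `p_X ≫ F f ⟶ p_Y` for each `(f, α)`. Every `(f, α)` is the cartesian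
`(f, 𝟙)` followed by the vertical `(𝟙, α)`. Once the cells at cartesian morphisms are identities,
only the vertical cells carry information, and these are the fibre action of a weighted cone.

In one direction the cell at `(f, α)` is the weighted cell at `f` followed by the action of `α`
(`ConeData.toElements`). In the other, the action of `α` is read off at `(𝟙, α)` (`ConeData.fib`).
The lemmas `leg_fib` and `fib_leg`, which compose a cell with a vertical one on either side, supply
functoriality, naturality and the fact that the two constructions are mutually inverse.

Modifications have the same components on both sides, and restriction along `u : U ⟶ V` whiskers
every cell by `u`, so the bijection is an isomorphism of categories, 2-natural in `U` (`conesIso`).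
Composing with it turns either universal property into the other. Uniqueness of the representing
object is the Yoneda argument `isoOfYonedaIso`. -/

namespace TwoLimits

attribute [-instance] catToReflQuiver

/-! ### Whiskering in a strict bicategory, up to equality 2-cells. -/

section Strict

variable {D : Type u₂} [Bicategory.{w₂, v₂} D]

theorem whiskerRight_congr {a b c : D} {f g : a ⟶ b} (η : f ⟶ g) {h k : b ⟶ c} (e : h = k) :
    η ▷ h = eqToHom (by rw [e]) ≫ η ▷ k ≫ eqToHom (by rw [e]) := by
  subst e
  simp

theorem whiskerLeft_congr {a b c : D} {h k : a ⟶ b} (e : h = k) {f g : b ⟶ c} (η : f ⟶ g) :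
    h ◁ η = eqToHom (by rw [e]) ≫ k ◁ η ≫ eqToHom (by rw [e]) := by
  subst e
  simp

variable [Strict D]

theorem whiskerRight_id_of_strict {a b : D} {f g : a ⟶ b} (η : f ⟶ g) :
    η ▷ 𝟙 b = eqToHom (Strict.comp_id f) ≫ η ≫ eqToHom (Strict.comp_id g).symm := by
  simp [Strict.rightUnitor_eqToIso]

theorem whiskerRight_comp_of_strict {a b c d : D} {f g : a ⟶ b} (η : f ⟶ g) (h : b ⟶ c)
    (k : c ⟶ d) :
    η ▷ (h ≫ k) =
      eqToHom (Strict.assoc f h k).symm ≫ η ▷ h ▷ k ≫ eqToHom (Strict.assoc g h k) := by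
  simp [Strict.associator_eqToIso]

theorem comp_comp_eq_id {a b c : D} {f : a ⟶ b} {f' : b ⟶ a} {g : b ⟶ c} {g' : c ⟶ b}
    (hf : f ≫ f' = 𝟙 a) (hg : g ≫ g' = 𝟙 b) : (f ≫ g) ≫ g' ≫ f' = 𝟙 a := by
  rw [Strict.assoc, ← Strict.assoc g, hg, Strict.id_comp, hf]

/-- The unit axiom of a lax transformation whose structure cells are equality 2-cells: by strictness
both sides are such 2-cells. `natural_comp_aux` is the composition axiom. -/
theorem natural_id_aux {a b : D} (f : a ⟶ b) {g : b ⟶ b} {h : a ⟶ a} (hg : 𝟙 b = g) (hh : 𝟙 a = h)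
    (e : f ≫ g = h ≫ f) :
    f ◁ eqToHom hg ≫ eqToHom e = (ρ_ f).hom ≫ (λ_ f).inv ≫ eqToHom hh ▷ f := by
  simp [Strict.leftUnitor_eqToIso, Strict.rightUnitor_eqToIso]

theorem natural_comp_aux {a b c a' b' c' : D} {p : a ⟶ a'} {q : b ⟶ b'} {r : c ⟶ c'}
    {f : a ⟶ b} {g : b ⟶ c} {f' : a' ⟶ b'} {g' : b' ⟶ c'} {k : a ⟶ c} {k' : a' ⟶ c'}
    (hk : f ≫ g = k) (hk' : f' ≫ g' = k') (e : p ≫ k' = k ≫ r) (e₁ : p ≫ f' = f ≫ q)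
    (e₂ : q ≫ g' = g ≫ r) :
    p ◁ eqToHom hk' ≫ eqToHom e = (α_ p f' g').inv ≫ eqToHom e₁ ▷ g' ≫ (α_ f q g').hom ≫
      f ◁ eqToHom e₂ ≫ (α_ f g r).inv ≫ eqToHom hk ▷ r := by
  simp [Strict.associator_eqToIso]

end Strict

/-! ### 2-natural transformations and isomorphisms from strictly natural families. -/

section TwoNaturality

open scoped Lax.LaxTrans

variable {B : Type u₁} [Bicategory.{w₁, v₁} B] {D : Type u₂} [Bicategory.{w₂, v₂} D] [Strict D]
  {M N P : StrictPseudofunctor B D}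

/-- A family of 1-cells strictly natural with respect to 1-cells and 2-cells is 2-natural. -/
def laxTransOfNatural (app : ∀ a, M.obj a ⟶ N.obj a)
    (h : ∀ ⦃a b : B⦄ (f : a ⟶ b), app a ≫ N.map f = M.map f ≫ app b)
    (h' : ∀ ⦃a b : B⦄ ⦃f g : a ⟶ b⦄ (η : f ⟶ g),
      app a ◁ N.map₂ η = eqToHom (h f) ≫ M.map₂ η ▷ app b ≫ eqToHom (h g).symm) :
    toLax M ⟶ toLax N where
  app := app
  naturality f := eqToHom (h f)
  naturality_naturality {a b f g} η := by
    change eqToHom (h f) ≫ M.map₂ η ▷ app b = app a ◁ N.map₂ η ≫ eqToHom (h g)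
    simp [h']
  naturality_id a := by
    rw [toLax_mapId, toLax_mapId]
    exact natural_id_aux _ _ _ _
  naturality_comp f g := by
    rw [toLax_mapComp, toLax_mapComp]
    exact natural_comp_aux _ _ _ _ _

theorem laxTransOfNatural_twoNatural (app : ∀ a, M.obj a ⟶ N.obj a)
    (h : ∀ ⦃a b : B⦄ (f : a ⟶ b), app a ≫ N.map f = M.map f ≫ app b)
    (h' : ∀ ⦃a b : B⦄ ⦃f g : a ⟶ b⦄ (η : f ⟶ g),
      app a ◁ N.map₂ η = eqToHom (h f) ≫ M.map₂ η ▷ app b ≫ eqToHom (h g).symm) :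
    TwoNatural M N (laxTransOfNatural app h h') :=
  fun _ _ f _ => ⟨h f, rfl⟩

namespace TwoNatIso

theorem inv_natural_of_hom_natural (app : ∀ a, M.obj a ⟶ N.obj a) (inv : ∀ a, N.obj a ⟶ M.obj a)
    (hi : ∀ a, app a ≫ inv a = 𝟙 _) (ih : ∀ a, inv a ≫ app a = 𝟙 _)
    (h : ∀ ⦃a b : B⦄ (f : a ⟶ b), app a ≫ N.map f = M.map f ≫ app b) ⦃a b : B⦄ (f : a ⟶ b) :
    inv a ≫ M.map f = N.map f ≫ inv b := by
  rw [← Strict.id_comp (N.map f), ← ih, Strict.assoc, Strict.assoc, ← Strict.assoc (app a), h,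
    Strict.assoc, hi, Strict.comp_id]

/-- Strictly natural families that are pointwise inverse are isomorphisms of 2-functors. -/
def ofNatural (app : ∀ a, M.obj a ⟶ N.obj a) (inv : ∀ a, N.obj a ⟶ M.obj a)
    (hi : ∀ a, app a ≫ inv a = 𝟙 _) (ih : ∀ a, inv a ≫ app a = 𝟙 _)
    (h : ∀ ⦃a b : B⦄ (f : a ⟶ b), app a ≫ N.map f = M.map f ≫ app b)
    (h' : ∀ ⦃a b : B⦄ ⦃f g : a ⟶ b⦄ (η : f ⟶ g),
      app a ◁ N.map₂ η = eqToHom (h f) ≫ M.map₂ η ▷ app b ≫ eqToHom (h g).symm) :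
    TwoNatIso M N where
  hom := laxTransOfNatural app h h'
  inv := laxTransOfNatural inv (inv_natural_of_hom_natural app inv hi ih h) (by
    intro a b f g η
    -- Inserting `inv a ≫ app a = 𝟙` here, and `app b ≫ inv b = 𝟙` in `e₂`, turns both sides into
    -- `inv a ◁ M.map₂ η ▷ app b ▷ inv b` up to equality 2-cells, through the known naturality `h'`.
    have e₁ : N.map₂ η = eqToHom (by rw [← Strict.assoc, ih, Strict.id_comp]) ≫
        inv a ◁ app a ◁ N.map₂ η ≫ eqToHom (by rw [← Strict.assoc, ih, Strict.id_comp]) := by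
      have := comp_whiskerLeft_aux (inv a) (app a) (N.map₂ η)
      rw [whiskerLeft_congr (ih a), id_whiskerLeft_aux] at this
      rw [← cancel_epi (eqToHom (by rw [ih, Strict.id_comp] :
        (inv a ≫ app a) ≫ N.map f = N.map f)), ← cancel_mono (eqToHom (by
          rw [ih, Strict.id_comp] : N.map g = (inv a ≫ app a) ≫ N.map g))]
      simpa using this
    have e₂ : M.map₂ η = eqToHom (by rw [Strict.assoc, hi, Strict.comp_id]) ≫
        M.map₂ η ▷ app b ▷ inv b ≫ eqToHom (by rw [Strict.assoc, hi, Strict.comp_id]) := by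
      have := whiskerRight_comp_of_strict (M.map₂ η) (app b) (inv b)
      rw [whiskerRight_congr _ (hi b), whiskerRight_id_of_strict] at this
      rw [← cancel_epi (eqToHom (by rw [hi, Strict.comp_id] :
        M.map f ≫ app b ≫ inv b = M.map f)), ← cancel_mono (eqToHom (by
          rw [hi, Strict.comp_id] : M.map g = M.map g ≫ app b ≫ inv b))]
      simpa using this
    rw [e₁, h']
    conv_lhs => rw [e₂]
    simp [Strict.associator_eqToIso])
  hom_natural := laxTransOfNatural_twoNatural _ _ _
  inv_natural := laxTransOfNatural_twoNatural _ _ _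
  hom_inv_id := hi
  inv_hom_id := ih

/-- The inverse isomorphism. -/
def symm (e : TwoNatIso M N) : TwoNatIso N M where
  hom := e.inv
  inv := e.hom
  hom_natural := e.inv_natural
  inv_natural := e.hom_natural
  hom_inv_id := e.inv_hom_id
  inv_hom_id := e.hom_inv_id

/-- Composition of isomorphisms of 2-functors. -/
def trans (e : TwoNatIso M N) (e' : TwoNatIso N P) : TwoNatIso M P where
  hom := e.hom ≫ e'.hom
  inv := e'.inv ≫ e.inv
  hom_natural := e.hom_natural.comp e'.hom_natural
  inv_natural := e'.inv_natural.comp e.inv_natural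
  hom_inv_id a := by
    change (e.hom.app a ≫ e'.hom.app a) ≫ e'.inv.app a ≫ e.inv.app a = _
    exact comp_comp_eq_id (e.hom_inv_id a) (e'.hom_inv_id a)
  inv_hom_id a := by
    change (e'.inv.app a ≫ e.inv.app a) ≫ e.hom.app a ≫ e'.hom.app a = _
    exact comp_comp_eq_id (e'.inv_hom_id a) (e.inv_hom_id a)

end TwoNatIso

end TwoNaturality

/-! ### The Yoneda argument for uniqueness of representing objects. -/

section Yoneda

variable {C : Type u} [Bicategory.{w, v} C] [Strict C]

open scoped Lax.LaxTrans in
-- An identity structure cell forces its source and target functors to be equal; this is that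
-- equality evaluated at `k`.
theorem yoneda_naturality {L L' : C} {φ : toLax (yoneda L) ⟶ toLax (yoneda L')}
    (hφ : TwoNatural _ _ φ) {U V : C} (u : U ⟶ V) (k : V ⟶ L) :
    u ≫ (show V ⟶ L' from (φ.app (op V)).toFunctor.obj k) =
      (φ.app (op U)).toFunctor.obj (show U ⟶ L from u ≫ k) :=
  congr(($((hφ u.op trivial).1)).toFunctor.obj k)

/-- Objects with isomorphic representables are isomorphic. -/
def isoOfYonedaIso {L L' : C} (e : TwoNatIso (yoneda L) (yoneda L')) : L ≅ L' where
  hom := (e.hom.app (op L)).toFunctor.obj (𝟙 L)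
  inv := (e.inv.app (op L')).toFunctor.obj (𝟙 L')
  hom_inv_id := by
    -- With `h` the image of `𝟙 L`, naturality of the inverse moves `h` inside: `h ≫ inv(𝟙) = inv(h
    -- ≫ 𝟙) = inv(h)`, which is `𝟙 L`.
    refine (yoneda_naturality e.inv_natural _ _).trans ?_
    refine Eq.trans (congrArg _ (Strict.comp_id _)) ?_
    exact congr(($(e.hom_inv_id (op L))).toFunctor.obj (𝟙 L))
  inv_hom_id := by
    refine (yoneda_naturality e.hom_natural _ _).trans ?_
    refine Eq.trans (congrArg _ (Strict.comp_id _)) ?_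
    exact congr(($(e.inv_hom_id (op L'))).toFunctor.obj (𝟙 L'))

end Yoneda

/-! ### Cones as explicit families of 1-cells and 2-cells. -/

section ConeData

open scoped Lax.LaxTrans

variable {B : Type u₁} [Bicategory.{w₁, v₁} B] {C : Type u} [Bicategory.{w, v} C] [Strict C]

/-- A lax transformation `M ⟶ C(U, G -)`, spelled out in terms of 1-cells and 2-cells of `C`. -/
structure ConeData (M : StrictPseudofunctor B Cat.{w, v}) (G : StrictPseudofunctor B C)
    (U : C) where
  obj {a : B} (X : M.obj a) : U ⟶ G.obj a
  map {a : B} {X Y : M.obj a} (α : X ⟶ Y) : obj X ⟶ obj Y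
  map_id {a : B} (X : M.obj a) : map (𝟙 X) = 𝟙 (obj X)
  map_comp {a : B} {X Y Z : M.obj a} (α : X ⟶ Y) (β : Y ⟶ Z) : map (α ≫ β) = map α ≫ map β
  cell {a b : B} (f : a ⟶ b) (X : M.obj a) :
    obj X ≫ G.map f ⟶ obj ((M.map f).toFunctor.obj X)
  cell_naturality {a b : B} (f : a ⟶ b) {X Y : M.obj a} (α : X ⟶ Y) :
    map α ▷ G.map f ≫ cell f Y = cell f X ≫ map ((M.map f).toFunctor.map α)
  cell_map₂ {a b : B} {f g : a ⟶ b} (η : f ⟶ g) (X : M.obj a) :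
    cell f X ≫ map ((M.map₂ η).toNatTrans.app X) = obj X ◁ G.map₂ η ≫ cell g X
  cell_id {a : B} (X : M.obj a) :
    cell (𝟙 a) X = eqToHom (by rw [G.map_id, Strict.comp_id, M.map_id]; rfl)
  cell_comp {a b c : B} (f : a ⟶ b) (g : b ⟶ c) (X : M.obj a) :
    cell (f ≫ g) X = eqToHom (by rw [G.map_comp, Strict.assoc]) ≫ cell f X ▷ G.map g ≫
      cell g ((M.map f).toFunctor.obj X) ≫ eqToHom (by rw [M.map_comp]; rfl)

namespace ConeData

variable {M : StrictPseudofunctor B Cat.{w, v}} {G : StrictPseudofunctor B C} {U : C}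

theorem map_eqToHom (D : ConeData M G U) {a : B} {X Y : M.obj a} (h : X = Y) :
    D.map (eqToHom h) = eqToHom (by rw [h]) := by
  subst h
  exact D.map_id _

theorem ext {D E : ConeData M G U} (h : ∀ ⦃a : B⦄ (X : M.obj a), D.obj X = E.obj X)
    (hmap : ∀ ⦃a : B⦄ ⦃X Y : M.obj a⦄ (α : X ⟶ Y),
      D.map α = eqToHom (h X) ≫ E.map α ≫ eqToHom (h Y).symm)
    (hcell : ∀ ⦃a b : B⦄ (f : a ⟶ b) (X : M.obj a),
      D.cell f X = eqToHom (by rw [h]) ≫ E.cell f X ≫ eqToHom (by rw [h])) : D = E := by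
  obtain ⟨obj, map, _, _, cell, _, _, _, _⟩ := D
  obtain ⟨obj', map', _, _, cell', _, _, _, _⟩ := E
  obtain rfl : @obj = @obj' := by
    funext a X
    exact h X
  obtain rfl : @map = @map' := by
    funext a X Y α
    simpa using hmap α
  obtain rfl : @cell = @cell' := by
    funext a b f X
    simpa using hcell f X
  rfl

/-- The lax transformation with given components. -/
def toLaxTrans (D : ConeData M G U) : toLax M ⟶ toLax (homFrom U G) where
  app a := Functor.toCatHom (C := M.obj a) (D := (U ⟶ G.obj a))
    { obj X := D.obj X
      map α := D.map α
      map_id := D.map_id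
      map_comp := D.map_comp }
  naturality {a b} f :=
    ⟨{ app X := D.cell f X
       naturality _ _ α := D.cell_naturality f α }⟩
  naturality_naturality η := by
    ext X
    exact D.cell_map₂ η X
  naturality_id a := by
    ext X
    have h := D.cell_id X
    -- The endpoints are left arbitrary so that the equalities between them can be eliminated by
    -- substitution; the actual endpoints are compound terms. The same device recurs below.
    have aux : ∀ {k l : U ⟶ G.obj a} {m : U ⟶ G.obj a} (x : k ⟶ l) (c : l ⟶ m) (y : k ⟶ m)
        (e : k = l) (e' : l = m), x = eqToHom e → c = eqToHom e' → y = eqToHom (e.trans e') →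
        x ≫ c = 𝟙 _ ≫ 𝟙 _ ≫ y := by
      rintro _ _ _ _ _ _ rfl rfl rfl rfl rfl
      simp
    refine aux _ _ _ _ _ (toLax_mapId_app (homFrom U G) a (D.obj X)) h ?_
    refine (congrArg D.map (toLax_mapId_app M a X)).trans (D.map_eqToHom _)
  naturality_comp {a b c} f g := by
    ext X
    have aux : ∀ {k l m m' n n' : U ⟶ G.obj c} (x : k ⟶ l) (d : l ⟶ m) (y : k ⟶ n) (z : n ⟶ n')
        (t : n' ⟶ m) (e : k = l) (e' : n' = m), x = eqToHom e → t = eqToHom e' →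
        d = eqToHom e.symm ≫ y ≫ z ≫ eqToHom e' →
        x ≫ d = 𝟙 _ ≫ y ≫ 𝟙 _ ≫ z ≫ 𝟙 _ ≫ t := by
      rintro _ _ _ _ _ _ _ _ _ _ _ rfl rfl rfl rfl rfl
      simp
    refine aux (m' := D.obj ((M.map (f ≫ g)).toFunctor.obj X)) _ _ _ _ _ _ _
      (toLax_mapComp_app (homFrom U G) f g (D.obj X)) ?_ (D.cell_comp f g X)
    refine (congrArg D.map (toLax_mapComp_app M f g X)).trans (D.map_eqToHom _)

/-- The components of a lax transformation. -/
def ofLaxTrans (σ : toLax M ⟶ toLax (homFrom U G)) : ConeData M G U where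
  obj {a} X := (σ.app a).toFunctor.obj X
  map {a} _ _ α := (σ.app a).toFunctor.map α
  map_id {a} X := (σ.app a).toFunctor.map_id X
  map_comp {a} _ _ _ α β := (σ.app a).toFunctor.map_comp α β
  cell f X := (σ.naturality f).toNatTrans.app X
  cell_naturality f _ _ α := (σ.naturality f).toNatTrans.naturality α
  cell_map₂ η X := congr(($(σ.naturality_naturality η)).toNatTrans.app X)
  cell_id {a} X := by
    have aux : ∀ {k l : U ⟶ G.obj a} {m : U ⟶ G.obj a} (x : k ⟶ l) (c : l ⟶ m) (y : k ⟶ m)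
        (e : k = l) (e' : l = m), x = eqToHom e → y = eqToHom (e.trans e') →
        x ≫ c = 𝟙 _ ≫ 𝟙 _ ≫ y → c = eqToHom e' := by
      rintro _ _ _ _ _ _ rfl rfl rfl rfl h
      simpa using h
    refine aux _ _ _ _ _ (toLax_mapId_app (homFrom U G) a ((σ.app a).toFunctor.obj X)) ?_
      congr(($(σ.naturality_id a)).toNatTrans.app X)
    refine (congrArg (σ.app a).toFunctor.map (toLax_mapId_app M a X)).trans (eqToHom_map _ _)
  cell_comp {a b c} f g X := by
    have aux : ∀ {k l m n n' : U ⟶ G.obj c} (x : k ⟶ l) (d : l ⟶ m) (y : k ⟶ n) (z : n ⟶ n')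
        (t : n' ⟶ m) (e : k = l) (e' : n' = m), x = eqToHom e → t = eqToHom e' →
        x ≫ d = 𝟙 _ ≫ y ≫ 𝟙 _ ≫ z ≫ 𝟙 _ ≫ t →
        d = eqToHom e.symm ≫ y ≫ z ≫ eqToHom e' := by
      rintro _ _ _ _ _ _ _ _ _ _ rfl rfl rfl rfl h
      simpa using h
    refine aux _ _ _ _ _ _ _
      (toLax_mapComp_app (homFrom U G) f g ((σ.app a).toFunctor.obj X)) ?_
      congr(($(σ.naturality_comp f g)).toNatTrans.app X)
    refine (congrArg (σ.app c).toFunctor.map (toLax_mapComp_app M f g X)).trans (eqToHom_map _ _)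

/-- The components of 2-cells in `S` are identities. -/
def Marked (S : ∀ ⦃a b : B⦄, (a ⟶ b) → Prop) (D : ConeData M G U) : Prop :=
  ∀ ⦃a b : B⦄ (f : a ⟶ b), S f → ∀ X : M.obj a, IsIdentity (D.cell f X)

end ConeData

end ConeData

/-! ### Cones and modifications through their components. -/

section Cones

open scoped Lax.LaxTrans

variable {B : Type u₁} [Bicategory.{w₁, v₁} B] {C : Type u} [Bicategory.{w, v} C] [Strict C]
  {S : ∀ ⦃a b : B⦄, (a ⟶ b) → Prop} {M : StrictPseudofunctor B Cat.{w, v}}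
  {G : StrictPseudofunctor B C} {U V : C}

theorem ConeData.marked_of_markedLax {σ : toLax M ⟶ toLax (homFrom U G)}
    (h : MarkedLax S M (homFrom U G) σ) : (ConeData.ofLaxTrans σ).Marked S := fun a b f hf X => by
  obtain ⟨h₁, h₂⟩ := h f hf
  exact ⟨congr(($h₁).toFunctor.obj X),
    congr(($h₂).toNatTrans.app X).trans (Cat.eqToHom_app _ _ _ _)⟩

theorem ConeData.Marked.markedLax {D : ConeData M G U} (h : D.Marked S) :
    MarkedLax S M (homFrom U G) D.toLaxTrans := fun _ _ f hf =>
  isIdentity_cat _ fun X => h f hf X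

namespace Cones

/-- The components of a cone. -/
def data (σ : Cones S M G U) : ConeData M G U := ConeData.ofLaxTrans σ.obj

theorem data_marked (σ : Cones S M G U) : σ.data.Marked S :=
  ConeData.marked_of_markedLax σ.property

/-- The cone with given components. -/
def ofData (D : ConeData M G U) (h : D.Marked S) : Cones S M G U := ⟨D.toLaxTrans, h.markedLax⟩

/-- Passing to components and back is definitionally the identity on transformations, so equality of
cones can be tested on 1-cells and 2-cells of `C`. -/
theorem ext_data {σ τ : Cones S M G U} (h : σ.data = τ.data) : σ = τ := by
  ext1
  exact congrArg ConeData.toLaxTrans h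

/-- The components of a modification between cones. -/
def Hom.app {σ τ : Cones S M G U} (Γ : σ ⟶ τ) {a : B} (X : M.obj a) :
    σ.data.obj X ⟶ τ.data.obj X :=
  (Γ.hom.as.app a).toNatTrans.app X

theorem Hom.naturality {σ τ : Cones S M G U} (Γ : σ ⟶ τ) {a : B} {X Y : M.obj a} (α : X ⟶ Y) :
    σ.data.map α ≫ Hom.app Γ Y = Hom.app Γ X ≫ τ.data.map α :=
  (Γ.hom.as.app a).toNatTrans.naturality α

theorem Hom.app_cell {σ τ : Cones S M G U} (Γ : σ ⟶ τ) {a b : B} (f : a ⟶ b) (X : M.obj a) :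
    Hom.app Γ X ▷ G.map f ≫ τ.data.cell f X =
      σ.data.cell f X ≫ Hom.app Γ ((M.map f).toFunctor.obj X) :=
  congr(($(Γ.hom.as.naturality f)).toNatTrans.app X)

/-- The modification with given components. -/
def homMk {σ τ : Cones S M G U} (app : ∀ {a : B} (X : M.obj a), σ.data.obj X ⟶ τ.data.obj X)
    (naturality : ∀ {a : B} {X Y : M.obj a} (α : X ⟶ Y),
      σ.data.map α ≫ app Y = app X ≫ τ.data.map α)
    (app_cell : ∀ {a b : B} (f : a ⟶ b) (X : M.obj a), app X ▷ G.map f ≫ τ.data.cell f X =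
      σ.data.cell f X ≫ app ((M.map f).toFunctor.obj X)) : σ ⟶ τ :=
  ObjectProperty.homMk
    { as :=
      { app a := ⟨{ app X := app X, naturality _ _ α := naturality α }⟩
        naturality f := by
          ext X
          exact app_cell f X } }

theorem hom_ext_eqToHom {σ σ' τ τ' : Cones S M G U} (h : σ = σ') (h' : τ' = τ)
    (Γ : σ ⟶ τ) (Γ' : σ' ⟶ τ') (H : ∀ {a : B} (X : M.obj a), Hom.app Γ X =
      eqToHom (by rw [h]) ≫ Hom.app Γ' X ≫ eqToHom (by rw [h'])) :
    Γ = eqToHom h ≫ Γ' ≫ eqToHom h' :=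
  cones_hom_ext h h' Γ Γ' fun _ X => H X

/-- The structure cell of a composite transformation also contains associators of `Cat`, whose
components are identities; only the associator of `C` survives. -/
theorem restrict_obj_cell (σ : Cones S M G V) (u : U ⟶ V) {a b : B} (f : a ⟶ b) (X : M.obj a) :
    ((restrict S M G u).obj σ).data.cell f X =
      (α_ u (σ.data.obj X) (G.map f)).hom ≫ u ◁ σ.data.cell f X := by
  refine Eq.trans (b := 𝟙 _ ≫ (α_ u (σ.data.obj X) (G.map f)).hom ≫ 𝟙 _ ≫
    u ◁ σ.data.cell f X ≫ 𝟙 _) rfl ?_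
  simp

end Cones

end Cones

/-! ### From weighted cones to cartesian-marked lax cones. -/

section Comparison

variable {A : Type u₁} [Bicategory.{w₁, v₁} A] {C : Type u} [Bicategory.{κ, κ} C] [Strict C]
  {W : StrictPseudofunctor A Cat.{κ, κ}} {F : StrictPseudofunctor A C} {U V : C}

/-- A cone weighted by `W`, as a lax cone on the 2-category of elements. -/
def ConeData.toElements (D : ConeData W F U) :
    ConeData (terminalWeight (Elements W)) ((Elements.proj W).comp F) U where
  obj {P} _ := D.obj P.fiber
  map _ := 𝟙 _
  map_id _ := rfl
  map_comp _ _ := (Category.comp_id _).symm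
  cell {P Q} ξ _ := D.cell ξ.base P.fiber ≫ D.map ξ.fiber
  cell_naturality {P Q} ξ _ _ _ := by
    refine Eq.trans (b := 𝟙 _ ▷ F.map ξ.base ≫ (D.cell ξ.base P.fiber ≫ D.map ξ.fiber)) rfl ?_
    rw [id_whiskerRight, Category.id_comp]
    exact (Category.comp_id _).symm
  cell_map₂ {P Q ξ ζ} η _ := by
    refine Eq.trans (b := (D.cell ξ.base P.fiber ≫ D.map ξ.fiber) ≫ 𝟙 _) rfl ?_
    refine Eq.trans ?_ (b := D.obj P.fiber ◁ F.map₂ (Elements.Hom₂.base η) ≫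
      D.cell ζ.base P.fiber ≫ D.map ζ.fiber) rfl
    -- The condition defining 2-cells of elements splits `ξ.fiber` into a component of `W(η)` and
    -- `ζ.fiber`; the first factor is absorbed by compatibility of the weighted cone with `η`.
    rw [Elements.Hom₂.w η, D.map_comp, Category.comp_id, ← Category.assoc, D.cell_map₂,
      Category.assoc]
  cell_id {P} _ := by
    refine Eq.trans (b := D.cell (𝟙 P.base) P.fiber ≫
      D.map ((W.mapId P.base).hom.toNatTrans.app P.fiber)) rfl ?_
    have e : (W.mapId P.base).hom.toNatTrans.app P.fiber = eqToHom (by rw [W.map_id]) := by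
      rw [W.mapId_eq_eqToIso]
      exact Cat.eqToHom_app _ _ (W.map_id _) _
    rw [D.cell_id, e, D.map_eqToHom]
    exact eqToHom_trans _ _
  cell_comp {P Q R} ξ ζ _ := by
    refine Eq.trans (b := D.cell (ξ.base ≫ ζ.base) P.fiber ≫
      D.map ((W.mapComp ξ.base ζ.base).hom.toNatTrans.app P.fiber ≫
        (W.map ζ.base).toFunctor.map ξ.fiber ≫ ζ.fiber)) rfl ?_
    refine Eq.trans ?_ (b := eqToHom (by rw [F.map_comp, Strict.assoc]) ≫
      (D.cell ξ.base P.fiber ≫ D.map ξ.fiber) ▷ F.map ζ.base ≫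
        (D.cell ζ.base Q.fiber ≫ D.map ζ.fiber) ≫ 𝟙 _) rfl
    have e : (W.mapComp ξ.base ζ.base).hom.toNatTrans.app P.fiber =
        eqToHom (by rw [W.map_comp]) := by
      rw [W.mapComp_eq_eqToIso]
      exact Cat.eqToHom_app _ _ (W.map_comp _ _) _
    -- A composite of elements carries `W(ζ.base)` applied to `ξ.fiber`; naturality of the cell at
    -- `ζ.base` moves that action to the other side of the cell.
    have n := D.cell_naturality ζ.base ξ.fiber
    rw [D.cell_comp, D.map_comp, D.map_comp, e, D.map_eqToHom]
    simp only [Category.assoc, comp_whiskerRight, Category.comp_id, eqToHom_trans_assoc,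
      eqToHom_refl, Category.id_comp, reassoc_of% n]

/-- At a cartesian morphism the fibre part is an equality morphism, and a functor sends it to an
equality 2-cell; the remaining factor is an identity by 2-naturality. -/
theorem ConeData.Marked.toElements {D : ConeData W F U} (h : D.Marked fun _ _ _ => True) :
    D.toElements.Marked Elements.IsCartesian := fun P Q ξ hξ _ => by
  obtain ⟨e, he⟩ := hξ
  change IsIdentity (D.cell ξ.base P.fiber ≫ D.map ξ.fiber)
  refine (h ξ.base trivial P.fiber).comp ?_
  rw [he, D.map_eqToHom]
  exact ⟨_, rfl⟩

variable (W F U) in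
/-- Weighted cones as cartesian-marked lax cones. -/
def toElements : Cones (fun _ _ _ => True) W F U ⥤
    Cones Elements.IsCartesian (terminalWeight (Elements W)) ((Elements.proj W).comp F) U where
  obj σ := Cones.ofData σ.data.toElements σ.data_marked.toElements
  map {σ τ} Γ := Cones.homMk (fun {P} _ => Cones.Hom.app Γ P.fiber)
    (fun _ => (Category.id_comp _).trans (Category.comp_id _).symm) (fun {P Q} ξ _ => by
      change Cones.Hom.app Γ P.fiber ▷ F.map ξ.base ≫
        (τ.data.cell ξ.base P.fiber ≫ τ.data.map ξ.fiber) =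
        (σ.data.cell ξ.base P.fiber ≫ σ.data.map ξ.fiber) ≫ Cones.Hom.app Γ Q.fiber
      rw [← Category.assoc, Cones.Hom.app_cell, Category.assoc, Category.assoc,
        Cones.Hom.naturality])
  map_id _ := rfl
  map_comp _ _ := rfl

theorem toElements_restrict_obj (u : U ⟶ V) (σ : Cones (fun _ _ _ => True) W F V) :
    (toElements W F U).obj ((restrict _ W F u).obj σ) =
      (restrict _ _ _ u).obj ((toElements W F V).obj σ) := by
  apply Cones.ext_data
  refine ConeData.ext (fun _ _ => rfl) (fun P X Y α => ?_) (fun P Q ξ X => ?_)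
  · refine Eq.trans ?_ (b := 𝟙 _ ≫ u ◁ 𝟙 (σ.data.obj P.fiber) ≫ 𝟙 _) rfl
    rw [whiskerLeft_id, Category.comp_id, Category.comp_id]
    rfl
  · refine Eq.trans (b := ((restrict _ W F u).obj σ).data.cell ξ.base P.fiber ≫
      ((restrict _ W F u).obj σ).data.map ξ.fiber) rfl ?_
    refine Eq.trans ?_ (b := 𝟙 _ ≫
      ((restrict _ _ _ u).obj ((toElements W F V).obj σ)).data.cell ξ X ≫ 𝟙 _) rfl
    refine Eq.trans (b := ((α_ u (σ.data.obj P.fiber) (F.map ξ.base)).hom ≫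
      u ◁ σ.data.cell ξ.base P.fiber) ≫ u ◁ σ.data.map ξ.fiber)
      (congrArg (· ≫ u ◁ σ.data.map ξ.fiber) (Cones.restrict_obj_cell σ u ξ.base P.fiber)) ?_
    refine (Category.assoc _ _ _).trans
      ((congrArg (_ ≫ ·) (whiskerLeft_comp u _ _).symm).trans ?_)
    refine (Cones.restrict_obj_cell ((toElements W F V).obj σ) u ξ X).symm.trans ?_
    exact (Category.comp_id _).symm.trans (Category.id_comp _).symm

end Comparison

/-! ### Chosen cartesian morphisms. -/

namespace Elements

variable {A : Type u₁} [Bicategory.{w₁, v₁} A] {W : StrictPseudofunctor A Cat.{w, v}}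

/-- The cartesian morphism `(f, 𝟙) : (A, X) ⟶ (B, W(f)(X))`. -/
def cart {a b : A} (f : a ⟶ b) (X : W.obj a) :
    (⟨a, X⟩ : Elements W) ⟶ ⟨b, (W.map f).toFunctor.obj X⟩ :=
  Hom.mk f (𝟙 _)

theorem isCartesian_cart {a b : A} (f : a ⟶ b) (X : W.obj a) : IsCartesian (cart f X) :=
  ⟨rfl, rfl⟩

end Elements

/-! ### Strict 2-functors on unitors and identities. -/

section StrictMaps

variable {A : Type u₁} [Bicategory.{w₁, v₁} A] {C : Type u} [Bicategory.{w, v} C] [Strict C]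

theorem map₂_rightUnitor_of_strict (F : StrictPseudofunctor A C) {a b : A} (f : a ⟶ b) :
    F.map₂ (ρ_ f).hom = eqToHom (by rw [F.map_comp, F.map_id, Strict.comp_id]) := by
  simp [F.map₂_right_unitor, F.mapId_eq_eqToIso, F.mapComp_eq_eqToIso, Strict.rightUnitor_eqToIso]

theorem map₂_leftUnitor_of_strict (F : StrictPseudofunctor A C) {a b : A} (f : a ⟶ b) :
    F.map₂ (λ_ f).hom = eqToHom (by rw [F.map_comp, F.map_id, Strict.id_comp]) := by
  simp [F.map₂_left_unitor, F.mapId_eq_eqToIso, F.mapComp_eq_eqToIso, Strict.leftUnitor_eqToIso]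

theorem whiskerRight_map_id_of_strict (F : StrictPseudofunctor A C) {U : C} {a : A}
    {k l : U ⟶ F.obj a} (η : k ⟶ l) : η ▷ F.map (𝟙 a) =
      eqToHom (by rw [F.map_id, Strict.comp_id]) ≫ η ≫
        eqToHom (by rw [F.map_id, Strict.comp_id]) := by
  rw [whiskerRight_congr η (F.map_id a), whiskerRight_id_of_strict]
  simp

end StrictMaps

/-! ### From cartesian-marked lax cones back to weighted cones. -/

section Comparison

variable {A : Type u₁} [Bicategory.{w₁, v₁} A] {C : Type u} [Bicategory.{κ, κ} C] [Strict C]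
  {W : StrictPseudofunctor A Cat.{κ, κ}} {F : StrictPseudofunctor A C} {U V : C}

namespace ConeData

variable (E : ConeData (terminalWeight (Elements W)) ((Elements.proj W).comp F) U)

/-- The 1-cells of a lax cone on the 2-category of elements. -/
def pt {a : A} (X : W.obj a) : U ⟶ F.obj a := E.obj (a := ⟨a, X⟩) ⟨⟨⟩⟩

/-- The structure 2-cell at `(f, α)` of a lax cone on the 2-category of elements. -/
def leg {a b : A} (f : a ⟶ b) {X : W.obj a} {Y : W.obj b}
    (α : (W.map f).toFunctor.obj X ⟶ Y) : E.pt X ≫ F.map f ⟶ E.pt Y :=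
  E.cell (a := ⟨a, X⟩) (b := ⟨b, Y⟩) (Elements.Hom.mk f α) ⟨⟨⟩⟩

/-- The hypothesis says exactly that `η` lifts to a 2-cell of elements; the terminal weight
contributes only an identity to the lax cone's compatibility with that lift. -/
theorem leg_map₂ {a b : A} {f g : a ⟶ b} (η : f ⟶ g) {X : W.obj a} {Y : W.obj b}
    {α : (W.map f).toFunctor.obj X ⟶ Y} {β : (W.map g).toFunctor.obj X ⟶ Y}
    (h : α = (W.map₂ η).toNatTrans.app X ≫ β) :
    E.leg f α = E.pt X ◁ F.map₂ η ≫ E.leg g β := by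
  let ξ : (⟨a, X⟩ : Elements W) ⟶ ⟨b, Y⟩ := Elements.Hom.mk f α
  let ζ : (⟨a, X⟩ : Elements W) ⟶ ⟨b, Y⟩ := Elements.Hom.mk g β
  let θ : ξ ⟶ ζ := Elements.Hom₂.mk η h
  refine Eq.trans ?_ (E.cell_map₂ θ ⟨⟨⟩⟩)
  refine Eq.trans ?_ (congrArg (E.leg f α ≫ ·) (E.map_id (a := ⟨b, Y⟩) ⟨⟨⟩⟩).symm)
  exact (Category.comp_id _).symm

theorem leg_id {a : A} (X : W.obj a) : E.leg (𝟙 a) (Y := X) ((W.mapId a).hom.toNatTrans.app X) =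
    eqToHom (by rw [F.map_id, Strict.comp_id]) :=
  E.cell_id (a := ⟨a, X⟩) ⟨⟨⟩⟩

theorem leg_comp {a b c : A} (f : a ⟶ b) (g : b ⟶ c) {X : W.obj a} {Y : W.obj b} {Z : W.obj c}
    (α : (W.map f).toFunctor.obj X ⟶ Y) (β : (W.map g).toFunctor.obj Y ⟶ Z) :
    E.leg (f ≫ g) ((W.mapComp f g).hom.toNatTrans.app X ≫ (W.map g).toFunctor.map α ≫ β) =
      eqToHom (by rw [F.map_comp, Strict.assoc]) ≫ E.leg f α ▷ F.map g ≫ E.leg g β := by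
  let ξ : (⟨a, X⟩ : Elements W) ⟶ ⟨b, Y⟩ := Elements.Hom.mk f α
  let ζ : (⟨b, Y⟩ : Elements W) ⟶ ⟨c, Z⟩ := Elements.Hom.mk g β
  refine Eq.trans (E.cell_comp ξ ζ ⟨⟨⟩⟩) ?_
  exact congrArg (eqToHom _ ≫ E.leg f α ▷ F.map g ≫ ·) (Category.comp_id (E.leg g β))

/-- The action of a lax cone on the morphisms `(𝟙, α)`. -/
def fib {a : A} {X Y : W.obj a} (α : X ⟶ Y) : E.pt X ⟶ E.pt Y :=
  eqToHom (by rw [F.map_id, Strict.comp_id]) ≫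
    E.leg (𝟙 a) ((W.mapId a).hom.toNatTrans.app X ≫ α)

theorem leg_id_comp {a : A} {X Y : W.obj a} (α : X ⟶ Y) :
    E.leg (𝟙 a) ((W.mapId a).hom.toNatTrans.app X ≫ α) =
      eqToHom (by rw [F.map_id, Strict.comp_id]) ≫ E.fib α := by
  simp [fib]

/-- The composite of `(f, α)` with the vertical `(𝟙, β)` lies over `f ≫ 𝟙`, and the right unitor,
lifted to elements, compares it with `(f, α ≫ β)`. For `α = 𝟙` this is the cartesian–vertical
factorization. -/
theorem leg_fib {a b : A} (f : a ⟶ b) {X : W.obj a} {Y Z : W.obj b}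
    (α : (W.map f).toFunctor.obj X ⟶ Y) (β : Y ⟶ Z) :
    E.leg f α ≫ E.fib β = E.leg f (α ≫ β) := by
  have h := E.leg_comp f (𝟙 b) α ((W.mapId b).hom.toNatTrans.app Y ≫ β)
  -- `F` sends the unitor to an equality 2-cell, so after these rewrites both sides differ from the
  -- claim only by an equality 2-cell, which is cancelled.
  rw [E.leg_map₂ (ρ_ f).hom (β := α ≫ β) (by simp), leg_id_comp, map₂_rightUnitor_of_strict,
    whiskerRight_map_id_of_strict, whiskerLeft_eqToHom] at h
  simp at h
  exact ((cancel_epi _).1 h).symm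

/-- The mirror image of `leg_fib`: precomposing with a vertical morphism transports `α` along
`W(f)`, and the left unitor plays the role of the right one. -/
theorem fib_leg {a b : A} (f : a ⟶ b) {X Y : W.obj a} {Z : W.obj b} (α : X ⟶ Y)
    (β : (W.map f).toFunctor.obj Y ⟶ Z) :
    E.fib α ▷ F.map f ≫ E.leg f β = E.leg f ((W.map f).toFunctor.map α ≫ β) := by
  have h := E.leg_comp (𝟙 a) f ((W.mapId a).hom.toNatTrans.app X ≫ α) β
  rw [E.leg_map₂ (λ_ f).hom (β := (W.map f).toFunctor.map α ≫ β) (by simp), leg_id_comp,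
    map₂_leftUnitor_of_strict, comp_whiskerRight, eqToHom_whiskerRight, whiskerLeft_eqToHom] at h
  simp at h
  exact ((cancel_epi _).1 h).symm

theorem fib_id {a : A} (X : W.obj a) : E.fib (𝟙 X) = 𝟙 _ := by
  simp [fib, leg_id]

theorem fib_comp {a : A} {X Y Z : W.obj a} (α : X ⟶ Y) (β : Y ⟶ Z) :
    E.fib (α ≫ β) = E.fib α ≫ E.fib β := by
  rw [fib, ← Category.assoc _ α β, ← leg_fib, ← Category.assoc]
  rfl

variable {E}

theorem Marked.isIdentity_leg (h : E.Marked Elements.IsCartesian) {a b : A} (f : a ⟶ b)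
    (X : W.obj a) : IsIdentity (E.leg f (𝟙 ((W.map f).toFunctor.obj X))) :=
  h _ (Elements.isCartesian_cart f X) ⟨⟨⟩⟩

/-- A cartesian-marked lax cone on the 2-category of elements, as a cone weighted by `W`. -/
def ofElements (h : E.Marked Elements.IsCartesian) : ConeData W F U where
  obj X := E.pt X
  map α := E.fib α
  map_id X := E.fib_id X
  map_comp α β := E.fib_comp α β
  cell f X := E.leg f (𝟙 _)
  cell_naturality f _ _ α := by
    -- Both sides are the cell at `(f, W(f)(α))`.
    rw [fib_leg, leg_fib, Category.comp_id, Category.id_comp]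
  cell_map₂ η X := by
    rw [leg_fib, E.leg_map₂ η (β := 𝟙 _) (by simp)]
  -- The marking enters here and in `cell_comp`: all cells involved are equality 2-cells, so only
  -- equality of their endpoints matters.
  cell_id X := (h.isIdentity_leg _ X).2
  cell_comp f g X := by
    rw [(h.isIdentity_leg f X).2, (h.isIdentity_leg g _).2, (h.isIdentity_leg (f ≫ g) X).2]
    simp

theorem marked_ofElements (h : E.Marked Elements.IsCartesian) :
    (ofElements h).Marked fun _ _ _ => True := fun _ _ f _ X => h.isIdentity_leg f X

theorem ofElements_toElements (D : ConeData W F U) (h : D.toElements.Marked Elements.IsCartesian) :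
    ofElements h = D := by
  refine ext (fun _ _ => rfl) (fun a X Y α => ?_) (fun a b f X => ?_)
  · refine Eq.trans (b := eqToHom (show D.obj X = D.obj X ≫ F.map (𝟙 a) by
      rw [F.map_id, Strict.comp_id]) ≫ D.cell (𝟙 a) X ≫
        D.map ((W.mapId a).hom.toNatTrans.app X ≫ α)) rfl ?_
    refine Eq.trans ?_ (b := 𝟙 _ ≫ D.map α ≫ 𝟙 _) rfl
    have e : (W.mapId a).hom.toNatTrans.app X = eqToHom (by rw [W.map_id]) := by
      rw [W.mapId_eq_eqToIso]
      exact Cat.eqToHom_app _ _ (W.map_id _) _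
    rw [D.map_comp, e, D.map_eqToHom, D.cell_id, eqToHom_trans_assoc, eqToHom_trans_assoc]
    exact congrArg (𝟙 _ ≫ ·) (Category.comp_id _).symm
  · refine Eq.trans (b := D.cell f X ≫ D.map (𝟙 _)) rfl ?_
    refine Eq.trans ?_ (b := 𝟙 _ ≫ D.cell f X ≫ 𝟙 _) rfl
    rw [D.map_id, Category.id_comp]

theorem toElements_ofElements (h : E.Marked Elements.IsCartesian) :
    (ofElements h).toElements = E := by
  refine ext (fun _ _ => rfl) (fun P X Y α => ?_) (fun P Q ξ X => ?_)
  · have e : X = Y := Subsingleton.elim (α := Discrete PUnit.{κ + 1}) X Y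
    subst e
    obtain rfl : α = 𝟙 X := rfl
    rw [map_id, map_id]
    exact (Category.id_comp _).symm.trans (congrArg _ (Category.id_comp _).symm)
  -- The rebuilt cell is the cartesian cell followed by the vertical one; `leg_fib` recombines them
  -- into the original cell at `ξ`.
  · refine Eq.trans (b := E.leg ξ.base (𝟙 _) ≫ E.fib ξ.fiber) rfl ?_
    rw [leg_fib, Category.id_comp]
    exact (Category.comp_id _).symm.trans (Category.id_comp _).symm

end ConeData

variable (W F U) in
/-- Cartesian-marked lax cones as weighted cones. -/
def ofElements :
    Cones Elements.IsCartesian (terminalWeight (Elements W)) ((Elements.proj W).comp F) U ⥤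
      Cones (fun _ _ _ => True) W F U where
  obj σ := Cones.ofData (ConeData.ofElements σ.data_marked)
    (ConeData.marked_ofElements σ.data_marked)
  map {σ τ} Γ := Cones.homMk (fun {a} X => Cones.Hom.app Γ (a := ⟨a, X⟩) ⟨⟨⟩⟩)
    (fun {a X Y} α => by
      let ξ : (⟨a, X⟩ : Elements W) ⟶ ⟨a, Y⟩ :=
        Elements.Hom.mk (𝟙 a) ((W.mapId a).hom.toNatTrans.app X ≫ α)
      let γ (X : W.obj a) : σ.data.pt X ⟶ τ.data.pt X := Cones.Hom.app Γ (a := ⟨a, X⟩) ⟨⟨⟩⟩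
      -- Naturality in the fibre direction is the modification axiom at the vertical morphism `(𝟙,
      -- α)`, after removing the whiskering by `F(𝟙)`.
      have h : γ X ▷ F.map (𝟙 a) ≫ τ.data.leg (𝟙 a) _ = σ.data.leg (𝟙 a) _ ≫ γ Y :=
        Cones.Hom.app_cell Γ ξ ⟨⟨⟩⟩
      rw [ConeData.leg_id_comp, ConeData.leg_id_comp, whiskerRight_map_id_of_strict] at h
      change σ.data.fib α ≫ γ Y = γ X ≫ τ.data.fib α
      simp at h
      exact ((cancel_epi _).1 h).symm)
    (fun {a b} f X => Cones.Hom.app_cell Γ (Elements.cart f X) ⟨⟨⟩⟩)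
  map_id _ := rfl
  map_comp _ _ := rfl

variable (W F U) in
theorem toElements_comp_ofElements : toElements W F U ⋙ ofElements W F U = 𝟭 _ :=
  CategoryTheory.Functor.ext
    (fun σ => Cones.ext_data (ConeData.ofElements_toElements σ.data σ.data_marked.toElements))
    fun _ _ _ => Cones.hom_ext_eqToHom _ _ _ _ fun _ =>
        (Category.comp_id _).symm.trans (Category.id_comp _).symm

variable (W F U) in
theorem ofElements_comp_toElements : ofElements W F U ⋙ toElements W F U = 𝟭 _ :=
  CategoryTheory.Functor.ext
    (fun σ => Cones.ext_data (ConeData.toElements_ofElements σ.data_marked)) fun _ _ _ =>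
      Cones.hom_ext_eqToHom _ _ _ _ fun _ =>
        (Category.comp_id _).symm.trans (Category.id_comp _).symm

end Comparison

/-! ### The 2-natural isomorphism of cone 2-functors. -/

section Main

variable {A : Type κ} [Bicategory.{κ, κ} A] {C : Type u} [Bicategory.{κ, κ} C] [Strict C]

/-- Weighted cones and cartesian-marked lax cones form isomorphic 2-functors. -/
def conesIso (W : StrictPseudofunctor A Cat.{κ, κ}) (F : StrictPseudofunctor A C) :
    TwoNatIso (cones (fun _ _ _ => True) W F)
      (cones Elements.IsCartesian (terminalWeight (Elements W)) ((Elements.proj W).comp F)) :=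
  TwoNatIso.ofNatural (fun U => (toElements W F U.unop).toCatHom)
    (fun U => (ofElements W F U.unop).toCatHom)
    (fun U => congrArg Functor.toCatHom (toElements_comp_ofElements W F U.unop))
    (fun U => congrArg Functor.toCatHom (ofElements_comp_toElements W F U.unop))
    (fun U _ u => cat_functor_ext (fun σ => (toElements_restrict_obj u.unop σ).symm)
      fun (_ _ : Cones _ W F U.unop) _ => Cones.hom_ext_eqToHom _ _ _ _ fun _ =>
        (Category.comp_id _).symm.trans (Category.id_comp _).symm)
    (fun U _ _ _ _ => cat_hom₂_ext _ _ _ _ fun (_ : Cones _ W F U.unop) =>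
      Cones.hom_ext_eqToHom _ _ _ _ fun _ =>
        (Category.comp_id _).symm.trans (Category.id_comp _).symm)

end Main

end TwoLimits

theorem mainTheorem8 {A : Type κ} [Bicategory.{κ, κ} A] [Strict A]
    {C : Type u} [Bicategory.{κ, κ} C] [Strict C]
    (F : StrictPseudofunctor A C) (W : StrictPseudofunctor A Cat.{κ, κ}) :
    (∀ L : C, Nonempty (TwoLimits.WeightedLimit W F L) ↔
      Nonempty (TwoLimits.CartesianLaxLimit W ((TwoLimits.Elements.proj W).comp F) L)) ∧
    (∀ L L' : C, Nonempty (TwoLimits.WeightedLimit W F L) →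
      Nonempty (TwoLimits.CartesianLaxLimit W ((TwoLimits.Elements.proj W).comp F) L') →
      Nonempty (L ≅ L')) :=
  ⟨fun _ => ⟨fun ⟨e⟩ => ⟨e.trans (TwoLimits.conesIso W F)⟩,
    fun ⟨e⟩ => ⟨e.trans (TwoLimits.conesIso W F).symm⟩⟩,
    fun _ _ ⟨e⟩ ⟨e'⟩ =>
      ⟨TwoLimits.isoOfYonedaIso ((e.trans (TwoLimits.conesIso W F)).trans e'.symm)⟩⟩
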